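/- Let $n\ge 1$, and let the local Hilbert space have a finite orthonormal basis $|i\rangle$ of vectors with definite fermion parity $|i|\in\{0,1\}$. An fMPS of bond dimension $2n$ is a family $\{A^i\}_i$ of complex $2n\times 2n$ matrices that has a grading matrix, i.e. a matrix $Z$ unitarily equivalent to $\sigma_z\otimes 1_n$ with $(-1)^{|i|}A^i=ZA^iZ$ for all $i$. It is injective with Wall invariant $(+)$ if, for some fixed $l\ge 1$, the products $A^{i_1}\cdots A^{i_l}$ span $\mathrm{M}_{2n}(\mathbb{C})$; its Wall matrices are then $u=\pm Z$. It is in canonical form if $\sum_i A^iA^{i\dagger}=1_{2n}$. With boundary matrix $\Omega$ it defines on $L$ sites the state $$|\{A^i\}_i,\Omega\rangle_L=\sum_{i_1,\dots,i_L}\mathrm{tr}[\Omega A^{i_1}\cdots A^{i_L}]\,|i_1,\dots,i_L\rangle .$$ **Theorem.** Let $\{A^i\}_i$ and $\{\tilde A^i\}_i$ be two injective fMPSs with Wall invariant $(+)$ in canonical form, with the same local Hilbert space and the same bond dimension $2n$. (a) They give the same physical state in APBC, i.e. for every $L\ge 1$ there is a phase $e^{i\alpha_L}$ with $|\{A^i\}_i,1_{2n}\rangle_L=e^{i\alpha_L}|\{\tilde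 A^i\}_i,1_{2n}\rangle_L$, if and only if there are a unitary matrix $V\in\mathrm{U}(2n)$ and a phase $e^{i\beta}\in\mathrm{U}(1)$ such that $$\tilde A^i=e^{i\beta}V^\dagger A^iV\quad\text{for all } i.$$ (b) For any Wall matrices $u$ of $\{A^i\}_i$ and $\tilde u$ of $\{\tilde A^i\}_i$, the same condition is necessary and sufficient for them to give the same physical state in PBC, i.e. for the existence, for every $L\ge 1$, of a phase $e^{i\alpha_L}$ with $|\{A^i\}_i,u\rangle_L=e^{i\alpha_L}|\{\tilde A^i\}_i,\tilde u\rangle_L$. (c) In both cases the phase $e^{i\beta}$ is unique and $V$ is unique up to a $\mathrm{U}(1)$ phase. (d) For every such $V$ and all Wall matrices $u$ of $\{A^i\}_i$ and $\tilde u$ of $\{\tilde A^i\}_i$ there is a sign $\eta\in\{\pm1\}$ with $\tilde u=\eta V^\dagger uV$. -/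

import Mathlib

namespace FMPS

/-- Complex `2n × 2n` matrices, with rows and columns indexed by `Fin 2 × Fin n`
(the index set of a Kronecker product of a `2 × 2` and an `n × n` matrix). -/
abbrev BondMatrix (n : ℕ) : Type := Matrix (Fin 2 × Fin n) (Fin 2 × Fin n) ℂ

/-- The matrix `σ_z ⊗ 1_n`. -/
def sigmaZ (n : ℕ) : BondMatrix n :=
  Matrix.kroneckerMap (fun a b => a * b) (!![1, 0; 0, -1] : Matrix (Fin 2) (Fin 2) ℂ)
    (1 : Matrix (Fin n) (Fin n) ℂ)

/-- `M ∼ᵤ N`: there is a unitary `U` with `M = U† N U`. -/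
def UnitarilyEquivalent {n : ℕ} (M N : BondMatrix n) : Prop :=
  ∃ U : Matrix.unitaryGroup (Fin 2 × Fin n) ℂ, M = star (U : BondMatrix n) * N * (U : BondMatrix n)

/-- `Z` is a grading matrix of `{A^i}`, where `|i| = parity i` is the fermion parity of the
basis vector `|i⟩` of the local Hilbert space:
`Z ∼ᵤ σ_z ⊗ 1_n` and `(-1)^{|i|} A^i = Z A^i Z` for all `i`. -/
def IsGradingMatrix {ι : Type*} {n : ℕ} (parity : ι → ZMod 2) (A : ι → BondMatrix n)
    (Z : BondMatrix n) : Prop :=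
  UnitarilyEquivalent Z (sigmaZ n) ∧
    ∀ i, ((-1 : ℂ) ^ (parity i).val) • A i = Z * A i * Z

/-- The space of fMPSs with bond dimension `2n`. -/
def space {ι : Type*} (parity : ι → ZMod 2) (n : ℕ) : Set (ι → BondMatrix n) :=
  {A | ∃ Z : BondMatrix n, IsGradingMatrix parity A Z}

/-- The ordered product `A^{i_1} ⋯ A^{i_L}`. -/
def word {ι : Type*} {n : ℕ} (A : ι → BondMatrix n) {L : ℕ} (i : Fin L → ι) : BondMatrix n :=
  (List.ofFn fun k => A (i k)).prod

/-- Injective fMPS with Wall invariant `(+)`: for some fixed length `l`, the products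
`A^{i_1} ⋯ A^{i_l}` span the space of all `2n × 2n` matrices. -/
def IsInjectivePlus {ι : Type*} {n : ℕ} (parity : ι → ZMod 2) (A : ι → BondMatrix n) : Prop :=
  A ∈ space parity n ∧
    ∃ l : ℕ, 0 < l ∧ Submodule.span ℂ (Set.range fun i : Fin l → ι => word A i) = ⊤

/-- Wall matrix of an fMPS with Wall invariant `(+)`: plus or minus a grading matrix. -/
def IsWallMatrixPlus {ι : Type*} {n : ℕ} (parity : ι → ZMod 2) (A : ι → BondMatrix n)
    (u : BondMatrix n) : Prop :=
  ∃ Z : BondMatrix n, IsGradingMatrix parity A Z ∧ (u = Z ∨ u = -Z)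

/-- Canonical form: `∑ i, A^i A^{i†} = 1`. -/
def IsCanonical {ι : Type*} [Fintype ι] {n : ℕ} (A : ι → BondMatrix n) : Prop :=
  ∑ i, A i * star (A i) = 1

/-- The state `|{A^i}, Ω⟩_L = ∑ tr(Ω A^{i_1} ⋯ A^{i_L}) |i_1, …, i_L⟩` on `L` sites, a vector of
the Hilbert space with orthonormal (occupation number) basis `|i_1, …, i_L⟩`. -/
noncomputable def state {ι : Type*} [Fintype ι] {n : ℕ} (A : ι → BondMatrix n)
    (Ω : BondMatrix n) (L : ℕ) : EuclideanSpace ℂ (Fin L → ι) :=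
  WithLp.toLp 2 fun i => Matrix.trace (Ω * word A i)

/-- `{A^i}` with boundary matrix `Ω` and `{B^i}` with boundary matrix `Ω'` give the same physical
state for every number `L` of sites: the two vectors agree up to a phase depending on `L`. -/
def SameStates {ι : Type*} [Fintype ι] {n : ℕ} (A : ι → BondMatrix n) (Ω : BondMatrix n)
    (B : ι → BondMatrix n) (Ω' : BondMatrix n) : Prop :=
  ∀ L : ℕ, 0 < L → ∃ z : Circle, state A Ω L = (z : ℂ) • state B Ω' L

/-- Gauge equivalence: same states under the anti-periodic boundary condition, for which the
boundary matrix is the identity. -/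
def GaugeEquivAPBC {ι : Type*} [Fintype ι] {n : ℕ} (A B : ι → BondMatrix n) : Prop :=
  SameStates A 1 B 1

/-- Gauge equivalence under the periodic boundary condition, for which the boundary matrices
are Wall matrices `u` of `{A^i}` and `w` of `{B^i}`. -/
def GaugeEquivPBC {ι : Type*} [Fintype ι] {n : ℕ} (A : ι → BondMatrix n) (u : BondMatrix n)
    (B : ι → BondMatrix n) (w : BondMatrix n) : Prop :=
  SameStates A u B w

/-- `B^i = z V† A^i V` for all `i`, with `V` unitary and `z` a phase. -/
def IsGaugeTransform {ι : Type*} {n : ℕ} (A B : ι → BondMatrix n)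
    (V : Matrix.unitaryGroup (Fin 2 × Fin n) ℂ) (z : Circle) : Prop :=
  ∀ i, B i = (z : ℂ) • (star (V : BondMatrix n) * A i * (V : BondMatrix n))

end FMPS

/-!
Suppose the states of `A` and `B`, with invertible boundary matrices `Ω` and `Ω'`, agree up to
nonzero factors. For large `m` the words of length `m` span the matrix space, and a linear relation
between words of length `m` is detected by traces against `Ω` and further words. Hence words in `A`
and `B` satisfy the same linear relations, and there are linear automorphisms `Φ m` of the matrix
space sending each word of length `m` in `A` to the same word in `B`
(`FMPS.SameStates.exists_transfer`). Concatenating words gives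
`Φ (m + k) (X * Y) = Φ m X * Φ k Y`. So `Φ m 1` is central, hence scalar, `Φ l` is a scalar
multiple of an algebra automorphism, and this automorphism is inner by Skolem–Noether. Comparing
the lengths `l` and `l + 1` yields `B i = c • (S * A i * S⁻¹)` (`FMPS.SameStates.exists_conj`). The
dependence of the phases on the length causes no trouble: only their being nonzero is used.

The canonical form makes `P = S⁻¹ * star S⁻¹` a positive definite eigenvector, with eigenvalue
`|c|⁻²`, of the unital map `X ↦ ∑ i, A i * X * star (A i)`. Positivity bounds the eigenvalue by `1`
(`FMPS.eigenvalue_le_one_of_posDef`), and exchanging `A` and `B` gives `|c| = 1`. A fixed point of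
this map is scalar because the words span (`FMPS.eq_smul_one_of_fixed`), so `S` is unitary up to a
positive factor.

The identity and Wall matrices are invertible, so this covers both boundary conditions. For the
converse and the uniqueness claims, matrices commuting with all words are scalar; in particular
the Wall matrices of a given family agree up to sign, so a gauge transformation carries `u` to
`± w`.
-/

namespace FMPS

open Matrix
open scoped ComplexOrder

/-! ### Linear algebra of full matrix algebras and of unital completely positive maps -/

section LinearAlgebra

/-- A linear map can be prescribed on a spanning family as soon as the prescription respects its
linear relations. -/
lemma exists_linearMap_of_span_eq_top {E F κ : Type*} [AddCommGroup E] [Module ℂ E]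
    [AddCommGroup F] [Module ℂ F] [Fintype κ] {v : κ → E} {w : κ → F}
    (hv : Submodule.span ℂ (Set.range v) = ⊤)
    (h : ∀ c : κ → ℂ, ∑ k, c k • v k = 0 → ∑ k, c k • w k = 0) :
    ∃ f : E →ₗ[ℂ] F, ∀ k, f (v k) = w k := by
  classical
  obtain ⟨g, hg⟩ := (Fintype.linearCombination ℂ v).exists_rightInverse_of_surjective
    (by rw [Fintype.range_linearCombination, hv])
  refine ⟨Fintype.linearCombination ℂ w ∘ₗ g, fun k => ?_⟩
  have h1 : Fintype.linearCombination ℂ v (g (v k)) = v k := DFunLike.congr_fun hg (v k)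
  have h2 := h (g (v k) - Pi.single k 1) (by
    rw [← Fintype.linearCombination_apply, map_sub, h1, Fintype.linearCombination_apply_single]
    simp)
  rw [← Fintype.linearCombination_apply, map_sub, Fintype.linearCombination_apply_single,
    one_smul, sub_eq_zero] at h2
  exact h2

/-- The quadratic form of `∑ i, A i * P * star (A i)` at `v` is the sum of those of `P` at the
vectors `star (A i) *ᵥ v`. -/
lemma dotProduct_sum_mul_mul_star {m ι : Type*} [Fintype m] [Fintype ι]
    {A : ι → Matrix m m ℂ} (P : Matrix m m ℂ) (v : m → ℂ) :
    star v ⬝ᵥ ((∑ i, A i * P * star (A i)) *ᵥ v) =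
      ∑ i, star (star (A i) *ᵥ v) ⬝ᵥ (P *ᵥ (star (A i) *ᵥ v)) := by
  rw [Matrix.sum_mulVec, dotProduct_sum]
  refine Finset.sum_congr rfl fun i _ => ?_
  rw [Matrix.star_mulVec, Matrix.star_eq_conjTranspose, Matrix.conjTranspose_conjTranspose,
    ← Matrix.dotProduct_mulVec, Matrix.mulVec_mulVec, Matrix.mulVec_mulVec]

variable {m : Type*} [Fintype m] [DecidableEq m]

lemma eq_smul_one_of_forall_commute {M : Matrix m m ℂ} (h : ∀ X, M * X = X * M) :
    ∃ c : ℂ, M = c • (1 : Matrix m m ℂ) := by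
  obtain ⟨c, hc⟩ := Matrix.mem_range_scalar_of_commute_single (M := M)
    (fun i j _ => (h (Matrix.single i j 1)).symm)
  exact ⟨c, by rw [← hc, Matrix.scalar_apply, Matrix.smul_one_eq_diagonal]⟩

/-- Skolem–Noether for the full matrix algebra: every automorphism is inner. -/
lemma exists_conj_of_algEquiv (f : Matrix m m ℂ ≃ₐ[ℂ] Matrix m m ℂ) :
    ∃ S S' : Matrix m m ℂ, S * S' = 1 ∧ S' * S = 1 ∧ ∀ X, f X = S * X * S' := by
  let t : Matrix m m ℂ ≃ₐ[ℂ] Module.End ℂ (m → ℂ) := Matrix.toLinAlgEquiv'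
  obtain ⟨T, hT⟩ := AlgEquiv.eq_linearEquivConjAlgEquiv ((t.symm.trans f).trans t)
  refine ⟨t.symm T.toLinearMap, t.symm T.symm.toLinearMap, ?_, ?_, fun X => ?_⟩
  · rw [← map_mul, ← map_one t.symm]
    congr 1; ext; simp
  · rw [← map_mul, ← map_one t.symm]
    congr 1; ext; simp
  · have h := congrArg t.symm (DFunLike.congr_fun hT (t X))
    simp only [AlgEquiv.trans_apply, AlgEquiv.symm_apply_apply] at h
    rw [h]
    conv_rhs => rw [← t.symm_apply_apply X]
    rw [← map_mul, ← map_mul]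
    congr 1

/-- The largest eigenvalue `r` of a Hermitian matrix `P`, with an eigenvector, and `P ≤ r • 1`. -/
lemma exists_max_eigenvector [Nonempty m] {P : Matrix m m ℂ} (hP : P.IsHermitian) :
    ∃ (r : ℝ) (v : m → ℂ), v ≠ 0 ∧ P *ᵥ v = (r : ℂ) • v ∧
      ((r : ℂ) • (1 : Matrix m m ℂ) - P).PosSemidef := by
  obtain ⟨j, hj⟩ := Finite.exists_max hP.eigenvalues
  refine ⟨hP.eigenvalues j, hP.eigenvectorBasis j, ?_, ?_, ?_⟩
  · intro h
    apply hP.eigenvectorBasis.toBasis.ne_zero j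
    ext i
    simpa using congrFun h i
  · rw [hP.mulVec_eigenvectorBasis j]
    ext; simp
  · have hsp := hP.spectral_theorem
    set U := hP.eigenvectorUnitary
    have hU : (U : Matrix m m ℂ) * star (U : Matrix m m ℂ) = 1 := Unitary.coe_mul_star_self U
    have : ((hP.eigenvalues j : ℝ) : ℂ) • (1 : Matrix m m ℂ) - P =
        (U : Matrix m m ℂ) * Matrix.diagonal
          (fun i => ((hP.eigenvalues j - hP.eigenvalues i : ℝ) : ℂ)) *
          (U : Matrix m m ℂ)ᴴ := by
      have hd : Matrix.diagonal (fun i => ((hP.eigenvalues j - hP.eigenvalues i : ℝ) : ℂ)) =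
          ((hP.eigenvalues j : ℝ) : ℂ) • (1 : Matrix m m ℂ) -
            Matrix.diagonal (RCLike.ofReal ∘ hP.eigenvalues) := by
        rw [Matrix.smul_one_eq_diagonal, Matrix.diagonal_sub]
        congr 1; ext i; simp
      rw [hd, Matrix.mul_sub, Matrix.sub_mul, Matrix.mul_smul, Matrix.smul_mul, Matrix.mul_one,
        ← Matrix.star_eq_conjTranspose, hU]
      congr 1
    rw [this]
    refine Matrix.PosSemidef.mul_mul_conjTranspose_same (Matrix.PosSemidef.diagonal ?_) _
    intro i
    simpa using hj i

variable {ι : Type*} [Fintype ι] {A : ι → Matrix m m ℂ}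

lemma sum_conj_smul_one_sub (hA : ∑ i, A i * star (A i) = 1) (r : ℂ) (P : Matrix m m ℂ) :
    ∑ i, A i * (r • (1 : Matrix m m ℂ) - P) * star (A i) =
      r • (1 : Matrix m m ℂ) - ∑ i, A i * P * star (A i) := by
  simp only [Matrix.mul_sub, Matrix.sub_mul, Matrix.mul_smul, Matrix.smul_mul, Matrix.mul_one,
    Finset.sum_sub_distrib, ← Finset.smul_sum, hA]

/-- A unital positive map has no positive definite eigenvector with eigenvalue above `1`: with `r`
the largest eigenvalue of `P` and `v` an eigenvector, `r • 1 - P ≥ 0` is mapped to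
`r • 1 - μ • P ≥ 0`, whose quadratic form at `v` is `r * (1 - μ) * ‖v‖²`. -/
lemma eigenvalue_le_one_of_posDef [Nonempty m] (hA : ∑ i, A i * star (A i) = 1)
    {P : Matrix m m ℂ} (hP : P.PosDef) {μ : ℝ}
    (h : ∑ i, A i * P * star (A i) = (μ : ℂ) • P) : μ ≤ 1 := by
  obtain ⟨r, v, hv, hPv, hQ⟩ := exists_max_eigenvector hP.1
  have h1 := sum_conj_smul_one_sub hA r P
  have h2 := dotProduct_sum_mul_mul_star (A := A) ((r : ℂ) • (1 : Matrix m m ℂ) - P) v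
  have h3 : 0 ≤ ∑ i, star (star (A i) *ᵥ v) ⬝ᵥ
      (((r : ℂ) • (1 : Matrix m m ℂ) - P) *ᵥ (star (A i) *ᵥ v)) :=
    Finset.sum_nonneg fun i _ => hQ.dotProduct_mulVec_nonneg _
  rw [← h2, h1, h, Matrix.sub_mulVec, Matrix.smul_mulVec, Matrix.smul_mulVec, hPv,
    Matrix.one_mulVec, smul_smul, ← sub_smul, dotProduct_smul] at h3
  have h4 : 0 < star v ⬝ᵥ v := Matrix.dotProduct_star_self_pos_iff.2 hv
  have h5 := hP.dotProduct_mulVec_pos hv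
  rw [hPv, dotProduct_smul] at h5
  rw [smul_eq_mul] at h3 h5
  obtain ⟨q, hq⟩ : ∃ q : ℝ, star v ⬝ᵥ v = (q : ℂ) :=
    ⟨_, Complex.eq_re_of_ofReal_le (r := 0) (by simp)⟩
  rw [hq] at h3 h4 h5
  have h6 : 0 ≤ (r - μ * r) * q := by exact_mod_cast h3
  have h7 : 0 < q := by exact_mod_cast h4
  have h8 : 0 < r * q := by exact_mod_cast h5
  nlinarith

/-- The kernel of a positive semidefinite fixed point `Q` of `X ↦ ∑ i, A i * X * star (A i)` is
invariant under all `star (A i)`: for `v` in the kernel, the nonnegative numbers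
`⟨star (A i) v, Q (star (A i) v)⟩` sum to `⟨v, Q v⟩ = 0`. -/
lemma mulVec_list_prod_star_eq_zero {Q : Matrix m m ℂ} (hQ : Q.PosSemidef)
    (h : ∑ i, A i * Q * star (A i) = Q) (s : List ι) {v : m → ℂ} (hv : Q *ᵥ v = 0) :
    Q *ᵥ (star (s.map A).prod *ᵥ v) = 0 := by
  induction s generalizing v with
  | nil => simpa using hv
  | cons a s ih =>
    rw [List.map_cons, List.prod_cons, star_mul, ← Matrix.mulVec_mulVec]
    apply ih
    have h2 := dotProduct_sum_mul_mul_star (A := A) Q v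
    rw [h, hv, dotProduct_zero, eq_comm,
      Finset.sum_eq_zero_iff_of_nonneg fun i _ => hQ.dotProduct_mulVec_nonneg _] at h2
    exact (hQ.dotProduct_mulVec_zero_iff _).1 (h2 a (Finset.mem_univ a))

/-- If the `A i` generate the full matrix algebra, then the Hermitian fixed points of the unital map
`X ↦ ∑ i, A i * X * star (A i)` are scalar. The matrix `r • 1 - P`, with `r` the largest
eigenvalue of `P`, has a nonzero kernel which is invariant under all matrices. -/
lemma eq_smul_one_of_fixed [Nonempty m] (hA : ∑ i, A i * star (A i) = 1)
    (hspan : Submodule.span ℂ (Set.range fun s : List ι => (s.map A).prod) = ⊤)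
    {P : Matrix m m ℂ} (hP : P.IsHermitian) (h : ∑ i, A i * P * star (A i) = P) :
    ∃ r : ℝ, P = (r : ℂ) • (1 : Matrix m m ℂ) := by
  obtain ⟨r, v, hv, hPv, hQ⟩ := exists_max_eigenvector hP
  refine ⟨r, ?_⟩
  set Q := (r : ℂ) • (1 : Matrix m m ℂ) - P with hQdef
  have hEQ : ∑ i, A i * Q * star (A i) = Q := by rw [sum_conj_smul_one_sub hA, h]
  have hQv : Q *ᵥ v = 0 := by
    rw [hQdef, Matrix.sub_mulVec, Matrix.smul_mulVec, Matrix.one_mulVec, hPv, sub_self]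
  have hall : ∀ X : Matrix m m ℂ, Q *ᵥ (star X *ᵥ v) = 0 := by
    intro X
    have hX : X ∈ Submodule.span ℂ (Set.range fun s : List ι => (s.map A).prod) := by
      rw [hspan]; trivial
    induction hX using Submodule.span_induction with
    | mem x hx =>
      obtain ⟨s, rfl⟩ := hx
      exact mulVec_list_prod_star_eq_zero hQ hEQ s hQv
    | zero => simp
    | add x y _ _ hx hy => rw [star_add, Matrix.add_mulVec, Matrix.mulVec_add, hx, hy, add_zero]
    | smul c x _ hx => rw [star_smul, Matrix.smul_mulVec, Matrix.mulVec_smul, hx, smul_zero]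
  have hQ0 : Q = 0 := by
    refine Matrix.ext_of_mulVec_single fun j => ?_
    -- `X = v e_j†` satisfies `X† v = ‖v‖² e_j`.
    have h1 := hall (Matrix.vecMulVec v (star (Pi.single j 1)))
    rw [Matrix.star_eq_conjTranspose, Matrix.conjTranspose_vecMulVec, star_star,
      Matrix.vecMulVec_mulVec] at h1
    have h4 : star v ⬝ᵥ v ≠ 0 := (Matrix.dotProduct_star_self_pos_iff.2 hv).ne'
    rw [op_smul_eq_smul, Matrix.mulVec_smul, smul_eq_zero] at h1
    rw [h1.resolve_left h4, Matrix.zero_mulVec]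
  exact (sub_eq_zero.1 hQ0).symm

end LinearAlgebra

/-! ### Words -/

section Words

variable {ι : Type*} {n : ℕ} {A B : ι → BondMatrix n}

lemma word_cons {L : ℕ} (a : ι) (i : Fin L → ι) :
    word A (Fin.cons a i : Fin (L + 1) → ι) = A a * word A i := by
  simp [word, List.ofFn_succ]

lemma word_append {L K : ℕ} (i : Fin L → ι) (j : Fin K → ι) :
    word A (Fin.append i j) = word A i * word A j := by
  have h : (fun k => A (Fin.append i j k)) = Fin.append (fun k => A (i k)) fun k => A (j k) := by
    funext k
    refine Fin.addCases (fun k => ?_) (fun k => ?_) k <;> simp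
  rw [word, h, List.ofFn_fin_append, List.prod_append, word, word]

variable (A) in
/-- The words of length `L` in the matrices `A i` span the full matrix algebra. -/
def WordsSpan (L : ℕ) : Prop :=
  Submodule.span ℂ (Set.range fun i : Fin L → ι => word A i) = ⊤

/-- As `∑ i, A i * star (A i) = 1`, every `X` is the combination `∑ i, A i * (star (A i) * X)` of
products of some `A i` with a combination of shorter words. -/
lemma WordsSpan.succ [Fintype ι] (hA : IsCanonical A) {L : ℕ} (h : WordsSpan A L) :
    WordsSpan A (L + 1) := by
  refine Submodule.eq_top_iff'.2 fun X => ?_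
  have hmul : ∀ a, ∀ Y : BondMatrix n,
      A a * Y ∈ Submodule.span ℂ (Set.range fun i : Fin (L + 1) → ι => word A i) := by
    intro a Y
    have hY : Y ∈ Submodule.span ℂ (Set.range fun i : Fin L → ι => word A i) := by
      rw [h]; trivial
    induction hY using Submodule.span_induction with
    | mem x hx =>
      obtain ⟨i, rfl⟩ := hx
      exact Submodule.subset_span ⟨Fin.cons a i, word_cons a i⟩
    | zero => simp
    | add x y _ _ hx hy => rw [mul_add]; exact add_mem hx hy
    | smul c x _ hx => rw [Matrix.mul_smul]; exact Submodule.smul_mem _ c hx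
  rw [← one_mul X, ← hA, Finset.sum_mul]
  exact Submodule.sum_mem _ fun a _ => by rw [mul_assoc]; exact hmul a _

lemma WordsSpan.of_le [Fintype ι] (hA : IsCanonical A) {L K : ℕ} (h : WordsSpan A L)
    (hLK : L ≤ K) : WordsSpan A K := by
  induction K, hLK using Nat.le_induction with
  | base => exact h
  | succ K _ ih => exact ih.succ hA

lemma WordsSpan.span_lists {L : ℕ} (h : WordsSpan A L) :
    Submodule.span ℂ (Set.range fun s : List ι => (s.map A).prod) = ⊤ := by
  refine top_unique (h.symm.le.trans (Submodule.span_mono ?_))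
  rintro _ ⟨i, rfl⟩
  exact ⟨List.ofFn i, by simp [word, List.map_ofFn, Function.comp_def]⟩

lemma WordsSpan.hom_ext {L : ℕ} (h : WordsSpan A L) {M : Type*} [AddCommGroup M] [Module ℂ M]
    {f g : BondMatrix n →ₗ[ℂ] M} (hfg : ∀ i : Fin L → ι, f (word A i) = g (word A i)) :
    f = g :=
  LinearMap.ext_on_range h hfg

lemma WordsSpan.commute {L : ℕ} (h : WordsSpan A L) {W : BondMatrix n}
    (hW : ∀ i, W * A i = A i * W) (X : BondMatrix n) : W * X = X * W := by
  have hword : ∀ s : List ι, W * (s.map A).prod = (s.map A).prod * W := by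
    intro s
    induction s with
    | nil => simp
    | cons a s ih => rw [List.map_cons, List.prod_cons, ← mul_assoc, hW, mul_assoc, ih, mul_assoc]
  refine DFunLike.congr_fun (h.hom_ext (f := LinearMap.mulLeft ℂ W)
    (g := LinearMap.mulRight ℂ W) fun i => ?_) X
  have := hword (List.ofFn i)
  simpa [word, List.map_ofFn, Function.comp_def] using this

/-- The maps sending words in `A` to the corresponding words in `B` are multiplicative across lengths,
because concatenation of words is. -/
lemma transfer_mul {f g h : BondMatrix n →ₗ[ℂ] BondMatrix n} {m k : ℕ}
    (hAm : WordsSpan A m) (hAk : WordsSpan A k)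
    (hf : ∀ i : Fin m → ι, f (word A i) = word B i)
    (hg : ∀ i : Fin k → ι, g (word A i) = word B i)
    (hh : ∀ i : Fin (m + k) → ι, h (word A i) = word B i) (X Y : BondMatrix n) :
    h (X * Y) = f X * g Y := by
  have hXY : (LinearMap.mul ℂ (BondMatrix n)).compr₂ h =
      (LinearMap.mul ℂ (BondMatrix n)).compl₁₂ f g :=
    hAm.hom_ext fun i => hAk.hom_ext fun j => by
      simp [← word_append, hf, hg, hh]
  exact DFunLike.congr_fun (DFunLike.congr_fun hXY X) Y

end Words

/-! ### From equal states to similar matrices -/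

section Transfer

variable {ι : Type*} [Fintype ι] {n : ℕ} {A B : ι → BondMatrix n}

/-- If the words of length `m + k` in `A` and `B` have proportional traces against `Ω` and `Ω'`, then
linear relations between the words of length `m` in `A` also hold for `B`: a relation is detected
by the traces against all words of length `k`, since `Ω'` is invertible and these words span. -/
lemma exists_transfer_map {Ω Ω' : BondMatrix n} (hΩ' : IsUnit Ω')
    {m k : ℕ} (hAm : WordsSpan A m) (hBk : WordsSpan B k) {z : ℂ} (hz : z ≠ 0)
    (h : ∀ i : Fin (m + k) → ι, trace (Ω * word A i) = z * trace (Ω' * word B i)) :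
    ∃ Φ : BondMatrix n →ₗ[ℂ] BondMatrix n, ∀ i : Fin m → ι, Φ (word A i) = word B i := by
  refine exists_linearMap_of_span_eq_top hAm fun c hc => ?_
  set Y := ∑ i, c i • word B i with hY
  have hword : ∀ j : Fin k → ι, trace (Ω' * Y * word B j) = 0 := by
    intro j
    have h1 : trace (Ω * (∑ i, c i • word A i) * word A j) =
        z * trace (Ω' * Y * word B j) := by
      simp only [hY, Finset.mul_sum, Finset.sum_mul, Matrix.trace_sum, Matrix.mul_smul,
        Matrix.smul_mul, Matrix.trace_smul, smul_eq_mul]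
      refine Finset.sum_congr rfl fun i _ => ?_
      rw [mul_assoc Ω, mul_assoc Ω', ← word_append, ← word_append, h]
      ring
    rw [hc, mul_zero, zero_mul, Matrix.trace_zero, eq_comm, mul_eq_zero] at h1
    exact h1.resolve_left hz
  have hall : ∀ X, trace (Ω' * Y * X) = 0 := fun X =>
    DFunLike.congr_fun (hBk.hom_ext
      (f := Matrix.traceLinearMap _ ℂ ℂ ∘ₗ LinearMap.mulLeft ℂ (Ω' * Y)) (g := 0) hword) X
  have h0 : Ω' * Y = 0 := Matrix.ext_iff_trace_mul_right.2 fun X => by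
    rw [hall, zero_mul, Matrix.trace_zero]
  exact hΩ'.mul_right_eq_zero.1 h0

/-- All that is used of the phases: the coefficients of the states are proportional, with a nonzero
factor that may depend on the length. -/
lemma SameStates.exists_ne_zero {Ω Ω' : BondMatrix n} (h : SameStates A Ω B Ω')
    {L : ℕ} (hL : 0 < L) :
    ∃ z : ℂ, z ≠ 0 ∧ ∀ i : Fin L → ι, trace (Ω * word A i) = z * trace (Ω' * word B i) := by
  obtain ⟨z, hz⟩ := h L hL
  refine ⟨z, z.coe_ne_zero, fun i => ?_⟩
  simpa [state] using congrArg (fun v : EuclideanSpace ℂ (Fin L → ι) => v i) hz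

lemma SameStates.symm {Ω Ω' : BondMatrix n} (h : SameStates A Ω B Ω') :
    SameStates B Ω' A Ω := by
  intro L hL
  obtain ⟨z, hz⟩ := h L hL
  exact ⟨z⁻¹, by rw [hz, smul_smul, ← Circle.coe_mul, inv_mul_cancel, Circle.coe_one, one_smul]⟩

/-- For every length `m ≥ l` the correspondence of words of length `m` extends to a linear
automorphism of the matrix space. The values at `m < l` are irrelevant. -/
lemma SameStates.exists_transfer {Ω Ω' : BondMatrix n} (h : SameStates A Ω B Ω')
    (hΩ : IsUnit Ω) (hΩ' : IsUnit Ω') {l : ℕ} (hl : 0 < l)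
    (hA : ∀ m, l ≤ m → WordsSpan A m) (hB : ∀ m, l ≤ m → WordsSpan B m) :
    ∃ Φ : ℕ → (BondMatrix n ≃ₗ[ℂ] BondMatrix n),
      ∀ m, l ≤ m → ∀ i : Fin m → ι, Φ m (word A i) = word B i := by
  have key : ∀ m, ∃ Φ : BondMatrix n ≃ₗ[ℂ] BondMatrix n,
      l ≤ m → ∀ i : Fin m → ι, Φ (word A i) = word B i := by
    intro m
    by_cases hm : l ≤ m
    · obtain ⟨z, hz, hzt⟩ := h.exists_ne_zero (L := m + l) (by omega)
      obtain ⟨y, hy, hyt⟩ := h.symm.exists_ne_zero (L := m + l) (by omega)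
      obtain ⟨f, hf⟩ := exists_transfer_map hΩ' (hA m hm) (hB l le_rfl) hz hzt
      obtain ⟨g, hg⟩ := exists_transfer_map hΩ (hB m hm) (hA l le_rfl) hy hyt
      refine ⟨LinearEquiv.ofLinearMap f g ?_ ?_, fun _ => hf⟩
      · exact (hB m hm).hom_ext fun i => by simp [hf, hg]
      · exact (hA m hm).hom_ext fun i => by simp [hf, hg]
    · exact ⟨LinearEquiv.refl ℂ _, fun h => absurd h hm⟩
  choose Φ hΦ using key
  exact ⟨Φ, hΦ⟩

/-- The boundary matrices need only be invertible for equal states to force the two families to be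
similar up to a scalar. -/
lemma SameStates.exists_conj {Ω Ω' : BondMatrix n} (hn : 0 < n) (h : SameStates A Ω B Ω')
    (hΩ : IsUnit Ω) (hΩ' : IsUnit Ω') {l : ℕ} (hl : 0 < l)
    (hA : ∀ m, l ≤ m → WordsSpan A m) (hB : ∀ m, l ≤ m → WordsSpan B m) :
    ∃ (c : ℂ) (S S' : BondMatrix n), S * S' = 1 ∧ S' * S = 1 ∧
      ∀ i, B i = c • (S * A i * S') := by
  have : NeZero n := ⟨hn.ne'⟩
  obtain ⟨Φ, hΦ⟩ := h.exists_transfer hΩ hΩ' hl hA hB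
  have hmul : ∀ m k, l ≤ m → l ≤ k → ∀ X Y, Φ (m + k) (X * Y) = Φ m X * Φ k Y := by
    intro m k hm hk X Y
    exact transfer_mul (f := (Φ m).toLinearMap) (g := (Φ k).toLinearMap)
      (h := (Φ (m + k)).toLinearMap) (hA m hm) (hA k hk) (hΦ m hm) (hΦ k hk)
      (hΦ (m + k) (by omega)) X Y
  -- `Φ m 1 * Φ l Y = Φ (m + l) Y = Φ l Y * Φ m 1`, and `Φ l` is onto.
  have hscalar : ∀ m, l ≤ m → ∃ e : ℂ, Φ m 1 = e • (1 : BondMatrix n) := by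
    intro m hm
    refine eq_smul_one_of_forall_commute fun X => ?_
    obtain ⟨Y, rfl⟩ := (Φ l).surjective X
    rw [← hmul m l hm le_rfl, ← hmul l m le_rfl hm, one_mul, mul_one, add_comm]
  obtain ⟨e, he⟩ := hscalar l le_rfl
  obtain ⟨d, hd⟩ := hscalar (l + 1) (by omega)
  have he0 : e ≠ 0 := by
    rintro rfl
    rw [zero_smul, LinearEquiv.map_eq_zero_iff] at he
    exact one_ne_zero he
  have hl2 : ∀ X, Φ (l + l) X = e • Φ l X := by
    intro X
    rw [← mul_one X, hmul l l le_rfl le_rfl, he, Matrix.mul_smul, mul_one, mul_one]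
  -- `Φ l X * Φ l Y = Φ (l + l) (X * Y) = e • Φ l (X * Y)`, so `e⁻¹ • Φ l` is multiplicative.
  let f : BondMatrix n ≃ₐ[ℂ] BondMatrix n :=
    AlgEquiv.ofLinearEquiv ((Φ l).trans (LinearEquiv.smulOfNeZero ℂ (BondMatrix n) e⁻¹
      (inv_ne_zero he0)))
      (by simp [he, he0])
      (fun X Y => by
        have h1 := hmul l l le_rfl le_rfl X Y
        rw [hl2] at h1
        have h2 : Φ l (X * Y) = e⁻¹ • (Φ l X * Φ l Y) := by
          rw [← h1, smul_smul, inv_mul_cancel₀ he0, one_smul]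
        simp [h2])
  have hf : ∀ X, f X = e⁻¹ • Φ l X := fun X => rfl
  obtain ⟨S, S', hSS', hS'S, hS⟩ := exists_conj_of_algEquiv f
  refine ⟨e⁻¹ * d, S, S', hSS', hS'S, fun a => ?_⟩
  -- Adding one letter in front of words of length `l` recovers `B a`; the scalar by which
  -- `Φ (l + 1)` differs from `Φ l` becomes the constant of proportionality.
  have hstep : ∀ Y, Φ (l + 1) (A a * Y) = B a * Φ l Y := fun Y =>
    DFunLike.congr_fun ((hA l le_rfl).hom_ext
      (f := (Φ (l + 1)).toLinearMap ∘ₗ LinearMap.mulLeft ℂ (A a))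
      (g := LinearMap.mulLeft ℂ (B a) ∘ₗ (Φ l).toLinearMap) fun i => by
        simp [← word_cons, hΦ l le_rfl, hΦ (l + 1) (by omega)]) Y
  have hlast : ∀ X, e • Φ (l + 1) X = d • Φ l X := by
    intro X
    have h1 := hmul (l + 1) l (by omega) le_rfl X 1
    have h2 := hmul (l + 1) l (by omega) le_rfl 1 X
    rw [mul_one, he, Matrix.mul_smul, mul_one] at h1
    rw [one_mul, hd, Matrix.smul_mul, one_mul] at h2
    rw [← h1, h2]
  have h3 := hstep 1
  rw [mul_one, he, Matrix.mul_smul, mul_one] at h3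
  rw [← hS, hf, ← smul_smul, smul_comm d, ← hlast, h3]
  simp [smul_smul, he0]

end Transfer

/-! ### Gauge transformations -/

section Gauge

variable {ι : Type*} {n : ℕ} {A B : ι → BondMatrix n}

section Canonical

variable [Fintype ι]

/-- The canonical form of `B = c • S A S⁻¹`, read as an eigenvector equation for the map
`X ↦ ∑ i, A i * X * star (A i)` at `P = S⁻¹ * star S⁻¹`. -/
lemma normSq_smul_sum_conj (hB : IsCanonical B) {c : ℂ} {S S' : BondMatrix n}
    (hS'S : S' * S = 1) (h : ∀ i, B i = c • (S * A i * S')) :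
    (Complex.normSq c : ℂ) • ∑ i, A i * (S' * star S') * star (A i) = S' * star S' := by
  have h1 : S' * (∑ i, B i * star (B i)) * star S' = S' * star S' := by rw [hB, mul_one]
  conv_rhs => rw [← h1, Finset.mul_sum, Finset.sum_mul]
  rw [Finset.smul_sum]
  refine Finset.sum_congr rfl fun i _ => ?_
  have h2 : S' * B i = c • (A i * S') := by
    rw [h, Matrix.mul_smul, mul_assoc S, ← mul_assoc S', hS'S, one_mul]
  have h3 : S' * (B i * star (B i)) * star S' = (S' * B i) * star (S' * B i) := by
    simp only [star_mul, mul_assoc]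
  rw [h3, h2, star_smul, star_mul, Matrix.smul_mul, Matrix.mul_smul, smul_smul,
    Complex.star_def, Complex.mul_conj]
  simp only [mul_assoc]

lemma posDef_mul_star_self_of_mul_eq_one {S S' : BondMatrix n} (hSS' : S * S' = 1) :
    (S' * star S').PosDef := by
  refine Matrix.PosDef.mul_conjTranspose_self S' ?_
  exact Matrix.vecMul_injective_of_isUnit
    (IsUnit.of_mul_eq_one S (mul_eq_one_comm.1 hSS'))

lemma one_le_normSq_of_conj (hn : 0 < n) (hA : IsCanonical A) (hB : IsCanonical B) {c : ℂ}
    (hc : c ≠ 0) {S S' : BondMatrix n} (hSS' : S * S' = 1)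
    (h : ∀ i, B i = c • (S * A i * S')) : 1 ≤ Complex.normSq c := by
  have : NeZero n := ⟨hn.ne'⟩
  have hc' : 0 < Complex.normSq c := Complex.normSq_pos.2 hc
  have h1 := normSq_smul_sum_conj hB (mul_eq_one_comm.1 hSS') h
  have h2 : ∑ i, A i * (S' * star S') * star (A i) =
      (((Complex.normSq c)⁻¹ : ℝ) : ℂ) • (S' * star S') := by
    conv_rhs => rw [← h1]
    rw [smul_smul, ← Complex.ofReal_mul, inv_mul_cancel₀ hc'.ne', Complex.ofReal_one, one_smul]
  have h3 := eigenvalue_le_one_of_posDef hA (posDef_mul_star_self_of_mul_eq_one hSS') h2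
  exact (inv_le_one₀ hc').1 h3

/-- A similarity up to scalar between canonical families is a gauge transformation. Applying
`one_le_normSq_of_conj` in both directions gives `|c| = 1`, so `S' * star S'` is a fixed point,
hence a positive scalar `r`, and `S' / √r` is the gauge unitary. -/
lemma exists_isGaugeTransform_of_conj (hn : 0 < n) (hA : IsCanonical A) (hB : IsCanonical B)
    {l : ℕ} (hspan : WordsSpan A l) {c : ℂ} {S S' : BondMatrix n}
    (hSS' : S * S' = 1) (hS'S : S' * S = 1) (h : ∀ i, B i = c • (S * A i * S')) :
    ∃ (V : Matrix.unitaryGroup (Fin 2 × Fin n) ℂ) (z : Circle), IsGaugeTransform A B V z := by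
  have : NeZero n := ⟨hn.ne'⟩
  have hc : c ≠ 0 := by
    rintro rfl
    have h0 : (0 : BondMatrix n) = 1 := by
      rw [← show ∑ i, B i * star (B i) = 1 from hB]
      simp [h]
    exact zero_ne_one h0
  have hinv : ∀ i, A i = c⁻¹ • (S' * B i * S) := by
    intro i
    rw [h, Matrix.mul_smul, Matrix.smul_mul, smul_smul, inv_mul_cancel₀ hc, one_smul,
      mul_assoc S, ← mul_assoc S', hS'S, one_mul, mul_assoc, hS'S, mul_one]
  have h1 := one_le_normSq_of_conj hn hA hB hc hSS' h
  have h2 := one_le_normSq_of_conj hn hB hA (inv_ne_zero hc) hS'S hinv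
  rw [map_inv₀] at h2
  have hnorm : Complex.normSq c = 1 :=
    le_antisymm ((one_le_inv₀ (zero_lt_one.trans_le h1)).1 h2) h1
  have hfix := normSq_smul_sum_conj hB hS'S h
  rw [hnorm, Complex.ofReal_one, one_smul] at hfix
  have hpos := posDef_mul_star_self_of_mul_eq_one hSS'
  obtain ⟨r, hr⟩ := eq_smul_one_of_fixed hA hspan.span_lists hpos.1 hfix
  have hr0 : 0 < r := by
    have h3 := hpos.diag_pos (i := 0)
    rw [hr] at h3
    simpa using h3
  have hs : (Real.sqrt r : ℂ) ≠ 0 := by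
    exact_mod_cast (Real.sqrt_pos.2 hr0).ne'
  have hss : (Real.sqrt r : ℂ) * Real.sqrt r = r := by
    exact_mod_cast Real.mul_self_sqrt hr0.le
  -- `S' * star S' = r`, so that `S' / √r` is unitary with adjoint `√r • S`
  have hstar : star S' = (r : ℂ) • S := by
    rw [← one_mul (star S'), ← hSS', mul_assoc, hr, Matrix.mul_smul, mul_one]
  have hstarV : star ((Real.sqrt r : ℂ)⁻¹ • S') = (Real.sqrt r : ℂ) • S := by
    rw [star_smul, hstar, smul_smul, ← hss, star_inv₀, Complex.star_def, Complex.conj_ofReal,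
      inv_mul_cancel_left₀ hs]
  refine ⟨⟨(Real.sqrt r : ℂ)⁻¹ • S', Matrix.mem_unitaryGroup_iff.2 ?_⟩, ⟨c, ?_⟩, fun i => ?_⟩
  · rw [hstarV, Matrix.smul_mul, Matrix.mul_smul, smul_smul, inv_mul_cancel₀ hs, one_smul, hS'S]
  · change c ∈ Metric.sphere (0 : ℂ) 1
    rw [mem_sphere_zero_iff_norm, ← pow_eq_one_iff_of_nonneg (norm_nonneg c) two_ne_zero,
      ← Complex.normSq_eq_norm_sq, hnorm]
  · change B i = c • (star ((Real.sqrt r : ℂ)⁻¹ • S') * A i * ((Real.sqrt r : ℂ)⁻¹ • S'))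
    rw [hstarV, h, Matrix.smul_mul, Matrix.smul_mul, Matrix.mul_smul, smul_smul (Real.sqrt r : ℂ),
      mul_inv_cancel₀ hs, one_smul]

lemma SameStates.exists_isGaugeTransform {parity : ι → ZMod 2} (hn : 0 < n)
    {Ω Ω' : BondMatrix n} (hΩ : IsUnit Ω) (hΩ' : IsUnit Ω') (hA : IsInjectivePlus parity A)
    (hB : IsInjectivePlus parity B) (hAc : IsCanonical A) (hBc : IsCanonical B)
    (h : SameStates A Ω B Ω') :
    ∃ (V : Matrix.unitaryGroup (Fin 2 × Fin n) ℂ) (z : Circle), IsGaugeTransform A B V z := by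
  obtain ⟨-, lA, hlA, hspanA⟩ := hA
  obtain ⟨-, lB, -, hspanB⟩ := hB
  have hA' : ∀ m, max lA lB ≤ m → WordsSpan A m := fun m hm =>
    WordsSpan.of_le hAc hspanA ((le_max_left _ _).trans hm)
  have hB' : ∀ m, max lA lB ≤ m → WordsSpan B m := fun m hm =>
    WordsSpan.of_le hBc hspanB ((le_max_right _ _).trans hm)
  obtain ⟨c, S, S', hSS', hS'S, hconj⟩ :=
    h.exists_conj hn hΩ hΩ' (lt_max_of_lt_left hlA) hA' hB'
  exact exists_isGaugeTransform_of_conj hn hAc hBc (hA' _ le_rfl) hSS' hS'S hconj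

end Canonical

variable {V V' : Matrix.unitaryGroup (Fin 2 × Fin n) ℂ} {z z' : Circle}

lemma IsGaugeTransform.word (h : IsGaugeTransform A B V z) {L : ℕ} (i : Fin L → ι) :
    word B i = (z : ℂ) ^ L • (star (V : BondMatrix n) * FMPS.word A i * (V : BondMatrix n)) := by
  have hV : (V : BondMatrix n) * star (V : BondMatrix n) = 1 := Unitary.coe_mul_star_self V
  have hV' : star (V : BondMatrix n) * (V : BondMatrix n) = 1 := Unitary.coe_star_mul_self V
  induction L with
  | zero => simp [FMPS.word, hV']
  | succ L ih =>
    rw [← Fin.cons_self_tail i, word_cons, word_cons, ih, h, Matrix.smul_mul, Matrix.mul_smul,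
      smul_smul, pow_succ']
    congr 1
    simp only [mul_assoc]
    rw [← mul_assoc (V : BondMatrix n) (star (V : BondMatrix n)), hV, one_mul]

lemma IsGaugeTransform.sameStates [Fintype ι] (h : IsGaugeTransform A B V z)
    {Ω Ω' : BondMatrix n} {η : Circle}
    (hΩ : Ω' = (η : ℂ) • (star (V : BondMatrix n) * Ω * (V : BondMatrix n))) :
    SameStates A Ω B Ω' := by
  have hV : (V : BondMatrix n) * star (V : BondMatrix n) = 1 := Unitary.coe_mul_star_self V
  intro L _
  refine ⟨(η * z ^ L)⁻¹, ?_⟩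
  ext i
  have h1 : trace (Ω' * FMPS.word B i) = (η * z ^ L : Circle) * trace (Ω * FMPS.word A i) := by
    have h2 : star (V : BondMatrix n) * Ω * (V : BondMatrix n) *
        (star (V : BondMatrix n) * FMPS.word A i * (V : BondMatrix n)) =
        star (V : BondMatrix n) * (Ω * FMPS.word A i * (V : BondMatrix n)) := by
      simp only [mul_assoc]
      rw [← mul_assoc (V : BondMatrix n) (star (V : BondMatrix n)), hV, one_mul]
    rw [h.word, hΩ, Matrix.smul_mul, Matrix.mul_smul, smul_smul, Matrix.trace_smul, h2,
      Matrix.trace_mul_comm, mul_assoc _ (V : BondMatrix n), hV, mul_one, smul_eq_mul,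
      Circle.coe_mul, Circle.coe_pow]
  simp only [state, PiLp.smul_apply, smul_eq_mul]
  rw [h1, ← mul_assoc, ← Circle.coe_mul, inv_mul_cancel, Circle.coe_one, one_mul]

lemma IsGaugeTransform.unique [Fintype ι] (hn : 0 < n) (hA : IsCanonical A) {l : ℕ}
    (hspan : WordsSpan A l) (h : IsGaugeTransform A B V z) (h' : IsGaugeTransform A B V' z') :
    z' = z ∧ ∃ c : Circle, (V' : BondMatrix n) = (c : ℂ) • (V : BondMatrix n) := by
  have : NeZero n := ⟨hn.ne'⟩
  have hV : (V : BondMatrix n) * star (V : BondMatrix n) = 1 := Unitary.coe_mul_star_self V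
  have hV' : (V' : BondMatrix n) * star (V' : BondMatrix n) = 1 := Unitary.coe_mul_star_self V'
  have hV'' : star (V' : BondMatrix n) * (V' : BondMatrix n) = 1 := Unitary.coe_star_mul_self V'
  -- `W = V' V†` intertwines words up to a scalar, which is `1` since the identity is a
  -- combination of words
  set W : BondMatrix n := V' * star (V : BondMatrix n) with hW
  have hWW : star W * W = 1 := by
    rw [hW, star_mul, star_star, mul_assoc, ← mul_assoc (star (V' : BondMatrix n)), hV'', one_mul,
      hV]
  have hword : ∀ {L : ℕ} (i : Fin L → ι),
      (z : ℂ) ^ L • (W * FMPS.word A i) = (z' : ℂ) ^ L • (FMPS.word A i * W) := by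
    intro L i
    have h1 := congrArg (fun X => (V' : BondMatrix n) * X * star (V : BondMatrix n))
      ((h.word i).symm.trans (h'.word i))
    simp only [Matrix.mul_smul, Matrix.smul_mul, mul_assoc, hV, mul_one] at h1
    rw [← mul_assoc (V' : BondMatrix n) (star (V' : BondMatrix n)), hV', one_mul,
      ← mul_assoc (V' : BondMatrix n)] at h1
    exact h1
  have hall : ∀ X, (z : ℂ) ^ l • (W * X) = (z' : ℂ) ^ l • (X * W) := fun X =>
    DFunLike.congr_fun (hspan.hom_ext (f := (z : ℂ) ^ l • LinearMap.mulLeft ℂ W)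
      (g := (z' : ℂ) ^ l • LinearMap.mulRight ℂ W) hword) X
  have hW0 : W ≠ 0 := by
    intro h0
    rw [h0, mul_zero] at hWW
    exact zero_ne_one hWW
  have hpow : (z : ℂ) ^ l = (z' : ℂ) ^ l := by
    have h1 := hall 1
    rw [mul_one, one_mul] at h1
    exact smul_left_injective ℂ hW0 h1
  have hcomm : ∀ X, W * X = X * W := by
    intro X
    have h1 := hall X
    rw [← hpow] at h1
    exact smul_right_injective _ (pow_ne_zero l z.coe_ne_zero) h1
  obtain ⟨c, hc⟩ := eq_smul_one_of_forall_commute hcomm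
  constructor
  · obtain ⟨a, ha⟩ : ∃ a, A a ≠ 0 := by
      by_contra! h0
      have h1 : (0 : BondMatrix n) = 1 := by
        rw [← show ∑ i, A i * star (A i) = 1 from hA]
        simp [h0]
      exact zero_ne_one h1
    -- The phase is read off from a single nonzero matrix `A a`.
    have h1 : (z : ℂ) • (W * A a) = (z' : ℂ) • (W * A a) := by
      have := hword (L := 1) fun _ => a
      simpa [FMPS.word, hcomm] using this
    have hne : W * A a ≠ 0 := fun h0 => ha (by
      rw [← one_mul (A a), ← hWW, mul_assoc, h0, mul_zero])
    exact (Circle.coe_injective (smul_left_injective ℂ hne h1)).symm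
  · have hcc : (starRingEnd ℂ c * c) • (1 : BondMatrix n) = (1 : ℂ) • 1 := by
      rw [hc, star_smul, star_one, Matrix.smul_mul, Matrix.mul_smul, one_mul, smul_smul] at hWW
      rw [one_smul]; exact hWW
    have hc1 := smul_left_injective ℂ (one_ne_zero (α := BondMatrix n)) hcc
    refine ⟨⟨c, ?_⟩, ?_⟩
    · change c ∈ Metric.sphere (0 : ℂ) 1
      rw [mem_sphere_zero_iff_norm, ← pow_eq_one_iff_of_nonneg (norm_nonneg c) two_ne_zero]
      rw [mul_comm, Complex.mul_conj, Complex.normSq_eq_norm_sq] at hc1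
      exact_mod_cast hc1
    · have h1 : W * (V : BondMatrix n) = V' := by
        rw [hW, mul_assoc, Unitary.coe_star_mul_self, mul_one]
      rw [← h1, hc, Matrix.smul_mul, one_mul]

end Gauge

/-! ### Grading and Wall matrices -/

section Grading

variable {ι : Type*} {n : ℕ} {parity : ι → ZMod 2} {A B : ι → BondMatrix n}

lemma sigmaZ_mul_self (n : ℕ) : sigmaZ n * sigmaZ n = 1 := by
  rw [sigmaZ, ← Matrix.mul_kronecker_mul]
  have : (!![1, 0; 0, -1] : Matrix (Fin 2) (Fin 2) ℂ) * !![1, 0; 0, -1] = 1 := by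
    rw [Matrix.mul_fin_two, Matrix.one_fin_two]; simp
  rw [this, mul_one, Matrix.one_kronecker_one]

lemma IsGradingMatrix.mul_self {Z : BondMatrix n} (h : IsGradingMatrix parity A Z) :
    Z * Z = 1 := by
  obtain ⟨⟨U, rfl⟩, -⟩ := h
  have hU : (U : BondMatrix n) * star (U : BondMatrix n) = 1 := Unitary.coe_mul_star_self U
  have hU' : star (U : BondMatrix n) * (U : BondMatrix n) = 1 := Unitary.coe_star_mul_self U
  simp only [mul_assoc]
  rw [← mul_assoc (U : BondMatrix n) (star (U : BondMatrix n)), hU, one_mul,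
    ← mul_assoc (sigmaZ n), sigmaZ_mul_self, one_mul, hU']

lemma IsWallMatrixPlus.mul_self {u : BondMatrix n} (h : IsWallMatrixPlus parity A u) :
    u * u = 1 := by
  obtain ⟨Z, hZ, rfl | rfl⟩ := h
  · exact hZ.mul_self
  · rw [neg_mul_neg, hZ.mul_self]

lemma IsWallMatrixPlus.isUnit {u : BondMatrix n} (h : IsWallMatrixPlus parity A u) :
    IsUnit u :=
  IsUnit.of_mul_eq_one u h.mul_self

lemma IsWallMatrixPlus.conj_eq {u : BondMatrix n} (h : IsWallMatrixPlus parity A u) (i : ι) :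
    u * A i * u = ((-1 : ℂ) ^ (parity i).val) • A i := by
  obtain ⟨Z, hZ, rfl | rfl⟩ := h
  · exact (hZ.2 i).symm
  · rw [hZ.2 i, neg_mul, neg_mul_neg]

/-- Two involutions that conjugate all `B i` in the same way agree up to sign: `w * u` commutes with
all `B i`, so it is a scalar, whose square is `1`. -/
lemma eq_or_eq_neg_of_conj_eq (hn : 0 < n) {l : ℕ} (hspan : WordsSpan B l) {u w : BondMatrix n}
    (hu : u * u = 1) (hw : w * w = 1) (h : ∀ i, u * B i * u = w * B i * w) :
    ∃ η : ℂ, (η = 1 ∨ η = -1) ∧ w = η • u := by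
  have : NeZero n := ⟨hn.ne'⟩
  have hcomm : ∀ i, (w * u) * B i = B i * (w * u) := by
    intro i
    calc w * u * B i = w * (u * B i * u) * u := by
          simp only [mul_assoc]; rw [hu, mul_one]
      _ = B i * (w * u) := by
          rw [h]; simp only [← mul_assoc]; rw [hw, one_mul, mul_assoc]
  obtain ⟨c, hc⟩ := eq_smul_one_of_forall_commute (hspan.commute hcomm)
  have hwu : w = c • u := by
    rw [← mul_one w, ← hu, ← mul_assoc, hc, Matrix.smul_mul, one_mul]
  refine ⟨c, ?_, hwu⟩
  rw [hwu, Matrix.smul_mul, Matrix.mul_smul, hu, smul_smul] at hw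
  have h1 : (c * c) • (1 : BondMatrix n) = (1 : ℂ) • 1 := by rw [hw, one_smul]
  exact mul_self_eq_one_iff.1 (smul_left_injective ℂ (one_ne_zero (α := BondMatrix n)) h1)

/-- `V† u V` is a Wall matrix of `B` as well, and Wall matrices are unique up to sign. -/
lemma IsGaugeTransform.wallMatrix_eq (hn : 0 < n) {l : ℕ} (hspan : WordsSpan B l)
    {u w : BondMatrix n} (hu : IsWallMatrixPlus parity A u) (hw : IsWallMatrixPlus parity B w)
    {V : Matrix.unitaryGroup (Fin 2 × Fin n) ℂ} {z : Circle} (h : IsGaugeTransform A B V z) :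
    ∃ η : ℂ, (η = 1 ∨ η = -1) ∧
      w = η • (star (V : BondMatrix n) * u * (V : BondMatrix n)) := by
  have hV : (V : BondMatrix n) * star (V : BondMatrix n) = 1 := Unitary.coe_mul_star_self V
  have hmul : ∀ X Y : BondMatrix n, star (V : BondMatrix n) * X * (V : BondMatrix n) *
      (star (V : BondMatrix n) * Y * (V : BondMatrix n)) =
      star (V : BondMatrix n) * (X * Y) * (V : BondMatrix n) := by
    intro X Y
    simp only [mul_assoc]
    rw [← mul_assoc (V : BondMatrix n) (star (V : BondMatrix n)), hV, one_mul]
  refine eq_or_eq_neg_of_conj_eq hn hspan ?_ hw.mul_self fun i => ?_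
  · rw [hmul, hu.mul_self, mul_one, Unitary.coe_star_mul_self]
  · rw [hw.conj_eq, h, Matrix.mul_smul, Matrix.smul_mul, hmul, hmul, hu.conj_eq, Matrix.mul_smul,
      Matrix.smul_mul, smul_comm]

end Grading

end FMPS

theorem theorem2 {ι : Type*} [Fintype ι] (parity : ι → ZMod 2) {n : ℕ} (hn : 0 < n)
    (A B : ι → FMPS.BondMatrix n)
    (hA : FMPS.IsInjectivePlus parity A) (hB : FMPS.IsInjectivePlus parity B)
    (hAc : FMPS.IsCanonical A) (hBc : FMPS.IsCanonical B) :
    -- same states in APBC iff related by a gauge transformation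
    (FMPS.GaugeEquivAPBC A B ↔
      ∃ (V : Matrix.unitaryGroup (Fin 2 × Fin n) ℂ) (z : Circle), FMPS.IsGaugeTransform A B V z) ∧
    -- same states in PBC iff related by a gauge transformation
    (∀ u w : FMPS.BondMatrix n,
      FMPS.IsWallMatrixPlus parity A u → FMPS.IsWallMatrixPlus parity B w →
      (FMPS.GaugeEquivPBC A u B w ↔
        ∃ (V : Matrix.unitaryGroup (Fin 2 × Fin n) ℂ) (z : Circle),
          FMPS.IsGaugeTransform A B V z)) ∧
    -- the phase is unique, and the unitary is unique up to a phase
    (∀ (V V' : Matrix.unitaryGroup (Fin 2 × Fin n) ℂ) (z z' : Circle),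
      FMPS.IsGaugeTransform A B V z → FMPS.IsGaugeTransform A B V' z' →
      z' = z ∧ ∃ c : Circle, (V' : FMPS.BondMatrix n) = (c : ℂ) • (V : FMPS.BondMatrix n)) ∧
    -- relation of the Wall matrices
    (∀ u w : FMPS.BondMatrix n,
      FMPS.IsWallMatrixPlus parity A u → FMPS.IsWallMatrixPlus parity B w →
      ∀ (V : Matrix.unitaryGroup (Fin 2 × Fin n) ℂ) (z : Circle),
        FMPS.IsGaugeTransform A B V z →
        ∃ η : ℂ, (η = 1 ∨ η = -1) ∧
          w = η • (star (V : FMPS.BondMatrix n) * u * (V : FMPS.BondMatrix n))) := by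
  obtain ⟨-, lA, -, hspanA⟩ := id hA
  obtain ⟨-, lB, -, hspanB⟩ := id hB
  refine ⟨⟨fun h => h.exists_isGaugeTransform hn isUnit_one isUnit_one hA hB hAc hBc, ?_⟩,
    fun u w hu hw =>
      ⟨fun h => h.exists_isGaugeTransform hn hu.isUnit hw.isUnit hA hB hAc hBc, ?_⟩,
    fun V V' z z' h h' => h.unique hn hAc hspanA h',
    fun u w hu hw V z h => h.wallMatrix_eq hn hspanB hu hw⟩
  · rintro ⟨V, z, h⟩
    exact h.sameStates (η := 1) (by simp)
  · rintro ⟨V, z, h⟩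
    obtain ⟨η, hη, hw'⟩ := h.wallMatrix_eq hn hspanB hu hw
    refine h.sameStates (η := ⟨η, ?_⟩) hw'
    change η ∈ Metric.sphere (0 : ℂ) 1
    rcases hη with rfl | rfl <;> simp
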